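/- Let $L$ be a finite-dimensional Lie algebra over a field $F$, let $N$ be its nilradical (the largest nilpotent ideal of $L$), let $Z(N)$ be the centre of $N$, and let $C=C_L(N)=\{x\in L:[x,N]=0\}$. For a finite-dimensional Lie algebra $U$ over $F$, let $\phi(U)$ denote its Frattini ideal, the largest ideal of $U$ contained in every maximal subalgebra of $U$. Call $U$ regular if $F$ has characteristic $0$, or if $F$ has characteristic $p>0$ and either the nilradical of $U$ has nilpotency class less than $p-1$ or the solvable radical of $U$ has derived length less than $\log_2 p$. A Lie algebra is semisimple if its solvable radical is zero; the zero algebra is semisimple. For subspaces, $\dot{+}$ denotes a direct sum of vector spaces; $\oplus$ denotes a direct sum of Lie algebras. Suppose that $C$ is regular. Then: (i) if $\phi(C)\cap Z(N)=0$, then $C=Z(N)\,\dot{+}\,B$ for some semisimple subalgebra $B$ of $L$ such that $B^2=[B,B]$ is an ideal of $L$; (ii) if $\phi(L)\cap Z(N)=0$, then $C=Z(N)\oplus B$ for some ideal $B$ of $L$ that is maximal (with respect to inclusion) among the semisimple ideals of $L$; (iii) if $F$ has characteristic zero, then $L$ has a largest semisimple ideal $S$ (one that contains every semisimple ideal of $L$),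 and $C=Z(N)\oplus S$. -/

import Mathlib

namespace LieNilrad

section
variable (F L : Type*) [Field F] [LieRing L] [LieAlgebra F L]

/-- The nilradical `N(L)`: the sum of all ideals of `L` that are nilpotent as Lie algebras.
For finite-dimensional `L` it is the largest nilpotent ideal. (Mathlib's `maxNilpotentIdeal` is a
different object: it asks for nilpotency of the action of all of `L`.) -/
def nilradical : LieIdeal F L :=
  sSup {I : LieIdeal F L | LieRing.IsNilpotent I}

/-- The Frattini ideal `φ(L)`: the largest ideal of `L` contained in every maximal subalgebra. -/
def frattiniIdeal : LieIdeal F L :=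
  sSup {I : LieIdeal F L | ∀ M : LieSubalgebra F L, IsCoatom M → ∀ x ∈ I, x ∈ M}

/-- `L` is nilregular: the characteristic is zero, or it is `p > 0` and the nilpotency class of
the nilradical is less than `p - 1`. -/
def IsNilregular : Prop :=
  CharZero F ∨
    LieModule.nilpotencyLength (nilradical F L) (nilradical F L) + 1 < ringChar F

/-- `L` is solregular: the characteristic is zero, or it is `p > 0` and the derived length of the
solvable radical is less than `log₂ p`. -/
def IsSolregular : Prop :=
  CharZero F ∨
    (0 < ringChar F ∧
      (LieAlgebra.derivedLength F (LieAlgebra.radical F L) : ℝ) < Real.logb 2 (ringChar F))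

/-- `L` is regular: it is nilregular or solregular. -/
def IsRegular : Prop :=
  IsNilregular F L ∨ IsSolregular F L

end

section
variable {F L : Type*} [Field F] [LieRing L] [LieAlgebra F L]

/-- The centraliser `C_L(I) = {x ∈ L : [x, I] = 0}` of an ideal `I`; it is again an ideal. -/
def centralizer (I : LieIdeal F L) : LieIdeal F L where
  carrier := {x | ∀ y ∈ I, ⁅x, y⁆ = 0}
  zero_mem' := fun y _ => zero_lie y
  add_mem' := fun {a b} ha hb y hy => by rw [add_lie, ha y hy, hb y hy, add_zero]
  smul_mem' := fun c x hx y hy => by rw [smul_lie, hx y hy, smul_zero]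
  lie_mem := fun {z x} hx y hy => by
    rw [lie_lie, hx y hy, hx ⁅z, y⁆ (lie_mem_right F L I z y hy), lie_zero, sub_zero]

/-- The centre `Z(I)` of an ideal `I`, as an ideal of the ambient algebra. -/
def centerOf (I : LieIdeal F L) : LieIdeal F L :=
  I ⊓ centralizer I

/-- `centerOf I` consists of the elements of the centre of the Lie algebra `I`. -/
theorem mem_centerOf_iff (I : LieIdeal F L) (x : L) :
    x ∈ centerOf I ↔ ∃ h : x ∈ I, (⟨x, h⟩ : I) ∈ LieAlgebra.center F I := by
  constructor
  · rintro ⟨h, hx⟩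
    refine ⟨h, (LieModule.mem_maxTrivSubmodule _ _ _ _).2 fun y => Subtype.ext ?_⟩
    have h0 : ⁅x, (y : L)⁆ = 0 := hx y y.2
    change ⁅(y : L), x⁆ = 0
    rw [← lie_skew, h0, neg_zero]
  · rintro ⟨h, hx⟩
    refine ⟨h, fun y hy => ?_⟩
    have h0 := congrArg Subtype.val ((LieModule.mem_maxTrivSubmodule _ _ _ _).1 hx ⟨y, hy⟩)
    change ⁅y, x⁆ = 0 at h0
    rw [← lie_skew, h0, neg_zero]

/-- The Frattini ideal `φ(I)` of the Lie algebra `I`, as a subspace of the ambient algebra. -/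
def frattiniOf (I : LieIdeal F L) : Submodule F L :=
  (frattiniIdeal F I).toSubmodule.map I.toSubmodule.subtype

/-- The square `B² = [B, B]` of a subalgebra: the span of all brackets of elements of `B`. -/
def square (B : LieSubalgebra F L) : Submodule F L :=
  Submodule.span F {z | ∃ x ∈ B, ∃ y ∈ B, ⁅x, y⁆ = z}

/-- `C = A ∔ B`, a direct sum of vector spaces. -/
def IsVectorDirectSum (C A B : Submodule F L) : Prop :=
  A ⊓ B = ⊥ ∧ A ⊔ B = C

/-- `C = A ⊕ B`, a direct sum of Lie algebras, for ideals `A` and `B`. -/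
def IsAlgebraDirectSum (C A B : LieIdeal F L) : Prop :=
  IsVectorDirectSum C.toSubmodule A.toSubmodule B.toSubmodule ∧
    ∀ a ∈ A, ∀ b ∈ B, ⁅a, b⁆ = 0

/-- An ideal is semisimple if, as a Lie algebra, its solvable radical is zero. This is the usual
meaning over fields of arbitrary characteristic. -/
def IsSemisimpleIdeal (I : LieIdeal F L) : Prop :=
  LieAlgebra.HasTrivialRadical F I

end

end LieNilrad

/-!
The point is that the radical of `C = C_L(N)` is `Z(N)`. A solvable ideal of `L` inside `C` lies
in `N`: going up its derived series, each term `I` has `[I, I] ≤ N` and `[I, N] = 0`, so that `I`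
is nilpotent. To use this for the radical of `C`, one needs ideals of `C` to be ideals of `L`, which
holds if they are stable under the derivations of `C`. Regularity ensures this, for the nilradical
or for the radical of `C`. The nilradical is enough: it then lies in `N`, so it is central in `C`,
and the first argument inside `C` shows that it equals the radical.

For a derivation `D` and an element `x` of the nilradical `N'` of `C`, the Leibniz formula gives
`(ad D) ^ n ((ad x) ^ n) ≡ n! (ad (D x)) ^ n` modulo the maps that shift the lower central series
of `N'`. Hence `N' + D N'` is nilpotent if `n!` is invertible, where `n - 1` is the class of `N'`.
Likewise, modulo the radical `R` of `C`, the `i`-th derived ideal of `R + D R` is contained in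
`D ^ (2 ^ i) (R⁽ⁱ⁾)` if `(2 ^ i)!` is invertible, so `R + D R` is solvable.

Every subalgebra complementing `Z(N)` in `C` is thus isomorphic to `C / rad C`. If `Z` is an abelian
ideal of `K` and `U` is a minimal subalgebra with `Z + U = K`, then `Z ∩ U` is an ideal contained in
every maximal subalgebra, so it vanishes when `φ(K) ∩ Z = 0`. Taking `K = C` gives a complement, and
`K = L` gives one whose intersection with `C` is an ideal.

In characteristic zero the complement is `[C, C]`. The quotient `S = C / Z(N)` has nondegenerate
Killing form and is perfect, so `Z(N) + [C, C] = C`. For a linear form `l` on `C` the cocycle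
`l [x, y]` descends to `S`, where it is a coboundary; so `l` agrees on `[C, C]` with a form that
vanishes on `Z(N)`, and hence `Z(N) ∩ [C, C] = 0`.
-/

namespace LieNilrad

section Leibniz

open Finset.HasAntidiagonal

variable {R M : Type*} [CommRing R] [AddCommGroup M] [Module R M]
  {B : M →ₗ[R] M →ₗ[R] M} {δ : Module.End R M}

theorem pow_leibniz (hδ : ∀ u v, δ (B u v) = B (δ u) v + B u (δ v)) (n : ℕ) (u v : M) :
    (δ ^ n) (B u v) =
      ∑ ij ∈ antidiagonal n, n.choose ij.1 • B ((δ ^ ij.1) u) ((δ ^ ij.2) v) := by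
  induction n with
  | zero => simp
  | succ n ih =>
    rw [Finset.sum_antidiagonal_choose_succ_nsmul
      (M := M) (fun i j => B ((δ ^ i) u) ((δ ^ j) v)) n]
    simp only [pow_succ', Module.End.mul_apply, ih, map_sum, map_nsmul, hδ, smul_add,
      Finset.sum_add_distrib]
    rw [add_comm]
    congr 1
    refine Finset.sum_congr rfl fun ij hij => ?_
    rw [Nat.choose_symm_of_eq_add (mem_antidiagonal.1 hij).symm]

variable {I : Submodule R M} {r s : ℕ} {u v : M}

theorem pow_leibniz_mem (hδ : ∀ u v, δ (B u v) = B (δ u) v + B u (δ v))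
    (hu : ∀ i < r, ∀ j, B ((δ ^ i) u) ((δ ^ j) v) ∈ I)
    (hv : ∀ j < s, ∀ i, B ((δ ^ i) u) ((δ ^ j) v) ∈ I) {n : ℕ} (hn : n < r + s) :
    (δ ^ n) (B u v) ∈ I := by
  rw [pow_leibniz hδ]
  refine sum_mem fun ⟨i, j⟩ hij => nsmul_mem ?_ _
  rw [mem_antidiagonal] at hij
  obtain hi | hj : i < r ∨ j < s := by omega
  exacts [hu i hi j, hv j hj i]

theorem pow_leibniz_sub_choose_smul_mem (hδ : ∀ u v, δ (B u v) = B (δ u) v + B u (δ v))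
    (hu : ∀ i < r, ∀ j, B ((δ ^ i) u) ((δ ^ j) v) ∈ I)
    (hv : ∀ j < s, ∀ i, B ((δ ^ i) u) ((δ ^ j) v) ∈ I) :
    (δ ^ (r + s)) (B u v) - (r + s).choose r • B ((δ ^ r) u) ((δ ^ s) v) ∈ I := by
  have hrs : (r, s) ∈ antidiagonal (r + s) := mem_antidiagonal.2 rfl
  rw [pow_leibniz hδ, ← Finset.add_sum_erase _ _ hrs, add_sub_cancel_left]
  refine sum_mem fun ⟨i, j⟩ hij => nsmul_mem ?_ _
  rw [Finset.mem_erase, mem_antidiagonal, Ne, Prod.mk.injEq] at hij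
  obtain hi | hj : i < r ∨ j < s := by omega
  exacts [hu i hi j, hv j hj i]

end Leibniz

section TwoSidedIdeal

variable {R E : Type*} [CommRing R] [Ring E] [Algebra R E] {A : Subalgebra R E}
  {I : Submodule R E}

theorem add_pow_sub_pow_mem (hAI : ∀ u ∈ A, ∀ v ∈ I, u * v ∈ I)
    (hIA : ∀ u ∈ I, ∀ v ∈ A, u * v ∈ I) {u v : E} (hu : u ∈ I) (huA : u ∈ A) (hv : v ∈ A)
    (m : ℕ) : (u + v) ^ m - v ^ m ∈ I := by
  induction m with
  | zero => simp
  | succ m ih =>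
    have hsucc : (u + v) ^ (m + 1) - v ^ (m + 1) =
        u * (u + v) ^ m + v * ((u + v) ^ m - v ^ m) := by
      rw [pow_succ', pow_succ', mul_sub, add_mul]; abel
    rw [hsucc]
    exact add_mem (hIA _ hu _ (pow_mem (add_mem huA hv) m)) (hAI _ hv _ ih)

variable {δ : Module.End R E} {a : E}

theorem pow_derivation_pow_mem (hAI : ∀ u ∈ A, ∀ v ∈ I, u * v ∈ I)
    (hIA : ∀ u ∈ I, ∀ v ∈ A, u * v ∈ I) (hδ : ∀ u v, δ (u * v) = δ u * v + u * δ v)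
    (hδA : ∀ u ∈ A, δ u ∈ A) (ha : a ∈ I) (haA : a ∈ A) {j m : ℕ} (hj : j < m) :
    (δ ^ j) (a ^ m) ∈ I := by
  have hδpow : ∀ i, ∀ u ∈ A, (δ ^ i) u ∈ A := fun i _ hu =>
    Module.End.pow_apply_mem_of_forall_mem (p := A.toSubmodule) i hδA _ hu
  induction m generalizing j with
  | zero => exact absurd hj j.not_lt_zero
  | succ m ih =>
    rw [pow_succ']
    refine pow_leibniz_mem (B := LinearMap.mul R E) (r := 1) (s := m) hδ (fun i hi k => ?_)
      (fun k hk i => hAI _ (hδpow i a haA) _ (ih hk)) (by omega)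
    rw [Nat.lt_one_iff.1 hi]
    exact hIA _ ha _ (hδpow k _ (pow_mem haA m))

theorem pow_derivation_pow_sub_factorial_smul_mem (hAI : ∀ u ∈ A, ∀ v ∈ I, u * v ∈ I)
    (hIA : ∀ u ∈ I, ∀ v ∈ A, u * v ∈ I) (hδ : ∀ u v, δ (u * v) = δ u * v + u * δ v)
    (hδA : ∀ u ∈ A, δ u ∈ A) (ha : a ∈ I) (haA : a ∈ A) (m : ℕ) :
    (δ ^ m) (a ^ m) - m.factorial • (δ a) ^ m ∈ I := by
  have hδpow : ∀ i, ∀ u ∈ A, (δ ^ i) u ∈ A := fun i _ hu =>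
    Module.End.pow_apply_mem_of_forall_mem (p := A.toSubmodule) i hδA _ hu
  induction m with
  | zero => simp
  | succ m ih =>
    have hlead := pow_leibniz_sub_choose_smul_mem (B := LinearMap.mul R E) (I := I) (r := 1)
      (s := m) (u := a) (v := a ^ m) hδ
      (fun i hi k => by
        rw [Nat.lt_one_iff.1 hi]
        exact hIA _ ha _ (hδpow k _ (pow_mem haA m)))
      (fun k hk i => hAI _ (hδpow i a haA) _
        (pow_derivation_pow_mem hAI hIA hδ hδA ha haA hk))
    have hrest := nsmul_mem (hAI (δ a) (hδA a haA) _ ih) (m + 1)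
    rw [mul_sub, mul_smul_comm, ← pow_succ', smul_sub, ← mul_smul, ← Nat.factorial_succ] at hrest
    convert add_mem hlead hrest using 1
    simp [add_comm 1 m, pow_succ' a]

end TwoSidedIdeal

section NilpotentIdeals

variable {R K : Type*} [CommRing R] [LieRing K] [LieAlgebra R K]

theorem lcs_succ_le_map_incl_lcs (N : LieIdeal R K) (j : ℕ) :
    N.lcs K (j + 1) ≤ (N.lcs N j).map (LieSubmodule.incl N) := by
  induction j with
  | zero => simp [LieSubmodule.lie_le_left]
  | succ j ih =>
    rw [LieIdeal.lcs_succ, LieIdeal.lcs_succ N N, LieSubmodule.map_bracket_eq]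
    exact LieSubmodule.mono_lie_right _ ih

theorem lowerCentralSeries_nilpotencyLength (M : Type*) [AddCommGroup M] [Module R M]
    [LieRingModule K M] [LieModule R K M] [LieModule.IsNilpotent K M] :
    LieModule.lowerCentralSeries R K M (LieModule.nilpotencyLength K M) = ⊥ := by
  rcases hk : LieModule.nilpotencyLength K M with _ | k
  · have := (LieModule.nilpotencyLength_eq_zero_iff K M).1 hk
    exact Subsingleton.elim _ _
  · exact ((LieModule.nilpotencyLength_eq_succ_iff R K M k).1 hk).1

theorem lcs_nilpotencyLength_succ (N : LieIdeal R K) [LieRing.IsNilpotent N] :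
    N.lcs K (LieModule.nilpotencyLength N N + 1) = ⊥ := by
  have hlcs : N.lcs N (LieModule.nilpotencyLength N N) = ⊥ := by
    rw [← LieSubmodule.toSubmodule_eq_bot, LieIdeal.coe_lcs_eq,
      lowerCentralSeries_nilpotencyLength, LieSubmodule.bot_toSubmodule]
  simpa [hlcs] using lcs_succ_le_map_incl_lcs N (LieModule.nilpotencyLength N N)

variable (R K) in
/-- The associative algebra of endomorphisms of `K` generated by the inner derivations. -/
def adAlgebra : Subalgebra R (Module.End R K) :=
  Algebra.adjoin R (Set.range (LieAlgebra.ad R K))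

theorem ad_mem_adAlgebra (x : K) : LieAlgebra.ad R K x ∈ adAlgebra R K :=
  Algebra.subset_adjoin ⟨x, rfl⟩

theorem apply_mem_of_mem_adAlgebra (J : LieIdeal R K) {T : Module.End R K}
    (hT : T ∈ adAlgebra R K) : ∀ v ∈ J, T v ∈ J := by
  induction hT using Algebra.adjoin_induction with
  | mem T hT =>
    obtain ⟨x, rfl⟩ := hT
    exact fun v hv => J.lie_mem hv
  | algebraMap r => exact fun v hv => J.smul_mem r hv
  | add S T _ _ hS hT => exact fun v hv => add_mem (hS v hv) (hT v hv)
  | mul _ T _ _ hS hT => exact fun v hv => hS _ (hT v hv)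

/-- The endomorphisms of `K` moving every term of the lower central series of `K` as an `N`-module
into the next one. For `N` nilpotent they are nilpotent, and they contain `ad x` for `x ∈ N`. -/
def lcsShift (N : LieIdeal R K) : Submodule R (Module.End R K) :=
  ⨅ j, (N.lcs K j).toSubmodule.compatibleMaps (N.lcs K (j + 1)).toSubmodule

variable {N : LieIdeal R K}

theorem mem_lcsShift {T : Module.End R K} :
    T ∈ lcsShift N ↔ ∀ j, ∀ v ∈ N.lcs K j, T v ∈ N.lcs K (j + 1) := by
  simp only [lcsShift, Submodule.mem_iInf]
  rfl

theorem ad_mem_lcsShift {x : K} (hx : x ∈ N) : LieAlgebra.ad R K x ∈ lcsShift N :=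
  mem_lcsShift.2 fun j v hv => by
    rw [LieIdeal.lcs_succ]
    exact LieSubmodule.lie_mem_lie hx hv

theorem mul_mem_lcsShift_of_mem_adAlgebra :
    ∀ S ∈ adAlgebra R K, ∀ T ∈ lcsShift N, S * T ∈ lcsShift N := fun _ hS _ hT =>
  mem_lcsShift.2 fun j v hv =>
    apply_mem_of_mem_adAlgebra (N.lcs K (j + 1)) hS _ (mem_lcsShift.1 hT j v hv)

theorem mul_mem_lcsShift_of_mem_lcsShift :
    ∀ S ∈ lcsShift N, ∀ T ∈ adAlgebra R K, S * T ∈ lcsShift N := fun _ hS _ hT =>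
  mem_lcsShift.2 fun j v hv =>
    mem_lcsShift.1 hS j _ (apply_mem_of_mem_adAlgebra (N.lcs K j) hT v hv)

theorem pow_eq_zero_of_mem_lcsShift {T : Module.End R K} (hT : T ∈ lcsShift N) {n : ℕ}
    (hn : N.lcs K n = ⊥) : T ^ n = 0 := by
  have hpow : ∀ j v, (T ^ j) v ∈ N.lcs K j := fun j v => by
    induction j with
    | zero => simp
    | succ j ih => rw [pow_succ']; exact mem_lcsShift.1 hT j _ ih
  ext v
  simpa [hn] using hpow n v

theorem isNilpotent_ad_add [LieRing.IsNilpotent N] {x z : K} (hx : x ∈ N) {m : ℕ}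
    (hz : LieAlgebra.ad R K z ^ m ∈ lcsShift N) : IsNilpotent (LieAlgebra.ad R K (x + z)) := by
  have hpow := add_mem (add_pow_sub_pow_mem mul_mem_lcsShift_of_mem_adAlgebra
    mul_mem_lcsShift_of_mem_lcsShift (ad_mem_lcsShift hx) (ad_mem_adAlgebra x)
    (ad_mem_adAlgebra z) m) hz
  rw [sub_add_cancel, ← map_add] at hpow
  refine ⟨m * (LieModule.nilpotencyLength N N + 1), ?_⟩
  rw [pow_mul]
  exact pow_eq_zero_of_mem_lcsShift hpow (lcs_nilpotencyLength_succ N)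

theorem isNilpotent_of_forall_isNilpotent_ad [IsNoetherian R K] {I : LieIdeal R K}
    (h : ∀ x ∈ I, IsNilpotent (LieAlgebra.ad R K x)) : LieRing.IsNilpotent I := by
  rw [LieAlgebra.isNilpotent_iff_forall (R := R)]
  intro x
  obtain ⟨n, hn⟩ := h x x.2
  have hpow : ∀ m (y : I), ((LieAlgebra.ad R I x ^ m) y : K) = (LieAlgebra.ad R K x ^ m) y := by
    intro m y
    induction m with
    | zero => rfl
    | succ m ih => rw [pow_succ', pow_succ', Module.End.mul_apply, Module.End.mul_apply, ← ih]; rfl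
  refine ⟨n, LinearMap.ext fun y => Subtype.ext ?_⟩
  rw [hpow, hn]
  rfl

theorem isNilpotent_ad_of_mem [LieRing.IsNilpotent N] {x : K} (hx : x ∈ N) :
    IsNilpotent (LieAlgebra.ad R K x) :=
  ⟨_, pow_eq_zero_of_mem_lcsShift (ad_mem_lcsShift hx) (lcs_nilpotencyLength_succ N)⟩

theorem isNilpotent_sup [IsNoetherian R K] (I J : LieIdeal R K) [LieRing.IsNilpotent I]
    [LieRing.IsNilpotent J] : LieRing.IsNilpotent (I ⊔ J : LieIdeal R K) := by
  refine isNilpotent_of_forall_isNilpotent_ad fun w hw => ?_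
  obtain ⟨x, hx, z, hz, rfl⟩ := (LieSubmodule.mem_sup _ _ _).1 hw
  obtain ⟨m, hm⟩ := isNilpotent_ad_of_mem (R := R) hz
  exact isNilpotent_ad_add hx (hm ▸ zero_mem (lcsShift I) : _ ^ m ∈ lcsShift I)

end NilpotentIdeals

section Nilradical

variable {F K : Type*} [Field F] [LieRing K] [LieAlgebra F K]

theorem le_nilradical (I : LieIdeal F K) [h : LieRing.IsNilpotent I] : I ≤ nilradical F K :=
  le_sSup h

instance isNilpotent_nilradical [FiniteDimensional F K] :
    LieRing.IsNilpotent (nilradical F K) := by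
  have hwf := LieSubmodule.wellFoundedGT_of_noetherian F K K
  rw [← CompleteLattice.isSupClosedCompact_iff_wellFoundedGT] at hwf
  refine hwf {I : LieIdeal F K | LieRing.IsNilpotent I} ⟨⊥, ?_⟩ fun I hI J hJ => ?_
  · change LieRing.IsNilpotent (⊥ : LieIdeal F K)
    infer_instance
  · have : LieRing.IsNilpotent I := hI
    have : LieRing.IsNilpotent J := hJ
    exact isNilpotent_sup I J

theorem le_nilradical_of_lie_le [FiniteDimensional F K] {I : LieIdeal F K}
    (hI : I ≤ centralizer (nilradical F K)) (hII : ⁅I, I⁆ ≤ nilradical F K) :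
    I ≤ nilradical F K := by
  have : LieRing.IsNilpotent I := isNilpotent_of_forall_isNilpotent_ad fun x hx => by
    refine ⟨3, LinearMap.ext fun v => ?_⟩
    exact hI hx _ (hII (LieSubmodule.lie_mem_lie hx (lie_mem_left F K I x v hx)))
  exact le_nilradical I

theorem le_nilradical_of_isSolvable [FiniteDimensional F K] (I : LieIdeal F K)
    [hs : LieAlgebra.IsSolvable I] (hI : I ≤ centralizer (nilradical F K)) :
    I ≤ nilradical F K := by
  obtain ⟨k, hk⟩ := (LieAlgebra.isSolvable_iff F (L := I)).1 hs
  rw [LieIdeal.derivedSeries_eq_bot_iff] at hk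
  have hle : LieAlgebra.derivedSeriesOfIdeal F K k I ≤ nilradical F K := hk ▸ bot_le
  clear hk
  induction k with
  | zero => exact hle
  | succ k ih =>
    rw [LieAlgebra.derivedSeriesOfIdeal_succ] at hle
    exact ih (le_nilradical_of_lie_le ((LieAlgebra.derivedSeriesOfIdeal_le_self I k).trans hI) hle)

end Nilradical

section AddDerivation

variable {R K : Type*} [CommRing R] [LieRing K] [LieAlgebra R K]

/-- A characteristic ideal: one that is stable under every derivation. -/
def IsCharacteristic (I : LieIdeal R K) : Prop :=
  ∀ D : LieDerivation R K K, ∀ x ∈ I, D x ∈ I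

/-- The ideal `I + D(I)` for an ideal `I` and a derivation `D`. A class of ideals with largest
member `I` that contains all the `I + D(I)` has `I` characteristic. -/
def addDerivation (I : LieIdeal R K) (D : LieDerivation R K K) : LieIdeal R K where
  toSubmodule := I.toSubmodule ⊔ I.toSubmodule.map D.toLinearMap
  lie_mem := by
    intro z w hw
    obtain ⟨y, hy, _, ⟨x, hx, rfl⟩, rfl⟩ := Submodule.mem_sup.1 hw
    have hlie : ⁅z, y + D x⁆ = (⁅z, y⁆ - ⁅D z, x⁆) + D ⁅z, x⁆ := by
      rw [LieDerivation.apply_lie_eq_add, lie_add]; abel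
    change ⁅z, y + D x⁆ ∈ I.toSubmodule ⊔ I.toSubmodule.map D.toLinearMap
    rw [hlie]
    exact Submodule.add_mem_sup (sub_mem (I.lie_mem hy) (I.lie_mem hx)) ⟨_, I.lie_mem hx, rfl⟩

variable {I : LieIdeal R K}

theorem mem_addDerivation {D : LieDerivation R K K} {w : K} :
    w ∈ addDerivation I D ↔ ∃ y ∈ I, ∃ x ∈ I, y + D x = w := by
  change w ∈ I.toSubmodule ⊔ I.toSubmodule.map D.toLinearMap ↔ _
  simp [Submodule.mem_sup]

theorem isCharacteristic_of_addDerivation_le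
    (h : ∀ D : LieDerivation R K K, addDerivation I D ≤ I) : IsCharacteristic I := fun D x hx =>
  h D (mem_addDerivation.2 ⟨0, zero_mem I, x, hx, zero_add _⟩)

end AddDerivation

section FactorialCast

variable {F K : Type*} [Field F] [LieRing K] [LieAlgebra F K]

theorem factorial_cast_ne_zero_of_lt {n : ℕ} (h : CharZero F ∨ n < ringChar F) :
    (n.factorial : F) ≠ 0 := by
  rcases h with _ | h
  · exact Nat.cast_ne_zero.2 n.factorial_ne_zero
  · have hp : (ringChar F).Prime :=
      (CharP.char_is_prime_or_zero F (ringChar F)).resolve_right (Nat.ne_zero_of_lt h)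
    rw [Ne, ringChar.spec, hp.dvd_factorial]
    exact not_le.2 h

theorem IsNilregular.factorial_ne_zero (h : IsNilregular F K) :
    ((LieModule.nilpotencyLength (nilradical F K) (nilradical F K) + 1).factorial : F) ≠ 0 :=
  factorial_cast_ne_zero_of_lt h

theorem IsSolregular.factorial_ne_zero (h : IsSolregular F K) :
    ((2 ^ LieAlgebra.derivedLength F (LieAlgebra.radical F K)).factorial : F) ≠ 0 := by
  refine factorial_cast_ne_zero_of_lt (h.imp_right fun ⟨hp, hlog⟩ => ?_)
  rw [Real.lt_logb_iff_rpow_lt one_lt_two (Nat.cast_pos.2 hp), Real.rpow_natCast] at hlog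
  exact_mod_cast hlog

end FactorialCast

section CharacteristicNilradical

attribute [local instance] LieRing.ofAssociativeRing

theorem lie_mul_eq_add {E : Type*} [Ring E] (d u v : E) : ⁅d, u * v⁆ = ⁅d, u⁆ * v + u * ⁅d, v⁆ := by
  simp only [Ring.lie_def]
  noncomm_ring

section CommRing

variable {R K : Type*} [CommRing R] [LieRing K] [LieAlgebra R K]

theorem lie_derivation_ad (D : LieDerivation R K K) (x : K) :
    ⁅(D : Module.End R K), LieAlgebra.ad R K x⁆ = LieAlgebra.ad R K (D x) :=
  LinearMap.ext fun v => by
    change D ⁅x, v⁆ - ⁅x, D v⁆ = ⁅D x, v⁆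
    rw [LieDerivation.apply_lie_eq_add, add_sub_cancel_left]

theorem lie_derivation_mem_adAlgebra (D : LieDerivation R K K) :
    ∀ T ∈ adAlgebra R K, ⁅(D : Module.End R K), T⁆ ∈ adAlgebra R K := by
  intro T hT
  induction hT using Algebra.adjoin_induction with
  | mem T hT =>
    obtain ⟨x, rfl⟩ := hT
    exact lie_derivation_ad D x ▸ ad_mem_adAlgebra (D x)
  | algebraMap r =>
    rw [Ring.lie_def, Algebra.commutes, sub_self]
    exact zero_mem _
  | add S T _ _ hS hT => exact (lie_add (D : Module.End R K) S T).symm ▸ add_mem hS hT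
  | mul S T hS hT hDS hDT =>
    exact (lie_mul_eq_add (D : Module.End R K) S T).symm ▸
      add_mem (mul_mem hDS hT) (mul_mem hS hDT)

end CommRing

variable {F K : Type*} [Field F] [LieRing K] [LieAlgebra F K]

theorem ad_derivation_pow_mem_lcsShift {N : LieIdeal F K} {n : ℕ} (hn : N.lcs K n = ⊥)
    (hfac : (n.factorial : F) ≠ 0) (D : LieDerivation F K K) {x : K} (hx : x ∈ N) :
    LieAlgebra.ad F K (D x) ^ n ∈ lcsShift N := by
  have hmem := pow_derivation_pow_sub_factorial_smul_mem mul_mem_lcsShift_of_mem_adAlgebra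
    mul_mem_lcsShift_of_mem_lcsShift
    (δ := LieAlgebra.ad F (Module.End F K) D) (lie_mul_eq_add D.toLinearMap)
    (lie_derivation_mem_adAlgebra D) (ad_mem_lcsShift hx) (ad_mem_adAlgebra x) n
  rwa [pow_eq_zero_of_mem_lcsShift (ad_mem_lcsShift hx) hn, map_zero, zero_sub, neg_mem_iff,
    LieAlgebra.ad_apply, lie_derivation_ad, ← Nat.cast_smul_eq_nsmul F,
    Submodule.smul_mem_iff _ hfac] at hmem

theorem IsNilregular.isCharacteristic_nilradical [FiniteDimensional F K]
    (h : IsNilregular F K) : IsCharacteristic (nilradical F K) := by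
  refine isCharacteristic_of_addDerivation_le fun D => ?_
  have : LieRing.IsNilpotent (addDerivation (nilradical F K) D) := by
    refine isNilpotent_of_forall_isNilpotent_ad fun w hw => ?_
    obtain ⟨y, hy, x, hx, rfl⟩ := mem_addDerivation.1 hw
    exact isNilpotent_ad_add hy (ad_derivation_pow_mem_lcsShift (lcs_nilpotencyLength_succ _)
      h.factorial_ne_zero D hx)
  exact le_nilradical _

end CharacteristicNilradical

section CharacteristicRadical

attribute [local instance] LieRing.ofAssociativeRing

section CommRing

variable {R K : Type*} [CommRing R] [LieRing K] [LieAlgebra R K]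

theorem pow_derivation_mem_of_mem_derivedSeriesOfIdeal (I : LieIdeal R K)
    (D : LieDerivation R K K) {i j : ℕ} (hj : j < 2 ^ i) :
    ∀ u ∈ LieAlgebra.derivedSeriesOfIdeal R K i I, (D.toLinearMap ^ j) u ∈ I := by
  induction i generalizing j with
  | zero =>
    obtain rfl : j = 0 := by simpa using hj
    exact fun u hu => hu
  | succ i ih =>
    change (LieAlgebra.derivedSeriesOfIdeal R K (i + 1) I).toSubmodule ≤
      I.toSubmodule.comap (D.toLinearMap ^ j)
    rw [LieAlgebra.derivedSeriesOfIdeal_succ, LieSubmodule.lieIdeal_oper_eq_linear_span',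
      Submodule.span_le]
    rintro _ ⟨u, hu, v, hv, rfl⟩
    exact pow_leibniz_mem (B := (LieAlgebra.ad R K).toLinearMap) (r := 2 ^ i) (s := 2 ^ i)
      (fun u v => (D.apply_lie_eq_add u v).trans (add_comm _ _))
      (fun k hk _ => lie_mem_left R K I _ _ (ih hk u hu))
      (fun k hk _ => lie_mem_right R K I _ _ (ih hk v hv)) (by rw [pow_succ] at hj; omega)

theorem pow_derivation_lie_sub_choose_smul_mem (I : LieIdeal R K) (D : LieDerivation R K K)
    {i : ℕ} {u v : K} (hu : u ∈ LieAlgebra.derivedSeriesOfIdeal R K i I)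
    (hv : v ∈ LieAlgebra.derivedSeriesOfIdeal R K i I) :
    (D.toLinearMap ^ (2 ^ i + 2 ^ i)) ⁅u, v⁆ - (2 ^ i + 2 ^ i).choose (2 ^ i) •
      ⁅(D.toLinearMap ^ 2 ^ i) u, (D.toLinearMap ^ 2 ^ i) v⁆ ∈ I :=
  pow_leibniz_sub_choose_smul_mem (I := I.toSubmodule) (B := (LieAlgebra.ad R K).toLinearMap)
    (fun u v => (D.apply_lie_eq_add u v).trans (add_comm _ _))
    (fun _ hk _ => lie_mem_left R K I _ _
      (pow_derivation_mem_of_mem_derivedSeriesOfIdeal I D hk u hu))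
    (fun _ hk _ => lie_mem_right R K I _ _
      (pow_derivation_mem_of_mem_derivedSeriesOfIdeal I D hk v hv))

theorem derivedSeriesOfIdeal_derivedLength (I : LieIdeal R K) [hs : LieAlgebra.IsSolvable I] :
    LieAlgebra.derivedSeriesOfIdeal R K (LieAlgebra.derivedLength R I) I = ⊥ := by
  rw [LieAlgebra.derivedLength_eq_derivedLengthOfIdeal]
  obtain ⟨k, hk⟩ := (LieAlgebra.isSolvable_iff R (L := I)).1 hs
  rw [LieIdeal.derivedSeries_eq_bot_iff] at hk
  exact Nat.sInf_mem (s := {k | LieAlgebra.derivedSeriesOfIdeal R K k I = ⊥}) ⟨k, hk⟩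

theorem isSolvable_of_derivedSeriesOfIdeal_le {I J : LieIdeal R K} [LieAlgebra.IsSolvable J]
    {k : ℕ} (h : LieAlgebra.derivedSeriesOfIdeal R K k I ≤ J) : LieAlgebra.IsSolvable I := by
  refine LieAlgebra.IsSolvable.mk (R := R) (k := LieAlgebra.derivedLength R J + k)
    ((LieIdeal.derivedSeries_eq_bot_iff _ _).2 ?_)
  rw [LieAlgebra.derivedSeriesOfIdeal_add, eq_bot_iff, ← derivedSeriesOfIdeal_derivedLength J]
  exact LieAlgebra.derivedSeriesOfIdeal_mono h _

end CommRing

variable {F K : Type*} [Field F] [LieRing K] [LieAlgebra F K]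

theorem derivedSeriesOfIdeal_addDerivation_le (I : LieIdeal F K) (D : LieDerivation F K K)
    {i : ℕ} (hfac : ((2 ^ i).factorial : F) ≠ 0) :
    (LieAlgebra.derivedSeriesOfIdeal F K i (addDerivation I D)).toSubmodule ≤ I.toSubmodule ⊔
      (LieAlgebra.derivedSeriesOfIdeal F K i I).toSubmodule.map (D.toLinearMap ^ 2 ^ i) := by
  induction i with
  | zero => exact le_of_eq (by simp [addDerivation])
  | succ i ih =>
    set d := D.toLinearMap
    set m := 2 ^ i
    have hm : 2 ^ (i + 1) = m + m := by rw [pow_succ]; omega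
    rw [hm] at hfac ⊢
    have ih := ih (ne_zero_of_dvd_ne_zero hfac
      (Nat.cast_dvd_cast (Nat.factorial_dvd_factorial (Nat.le_add_right m m))))
    have hchoose : ((m + m).choose m : F) ≠ 0 := by
      rw [← Nat.add_choose_mul_factorial_mul_factorial, mul_assoc, Nat.cast_mul] at hfac
      exact left_ne_zero_of_mul hfac
    rw [LieAlgebra.derivedSeriesOfIdeal_succ, LieSubmodule.lieIdeal_oper_eq_linear_span',
      Submodule.span_le]
    rintro _ ⟨x, hx, y, hy, rfl⟩
    obtain ⟨a, ha, _, ⟨u, hu, rfl⟩, rfl⟩ := Submodule.mem_sup.1 (ih hx)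
    obtain ⟨b, hb, _, ⟨v, hv, rfl⟩, rfl⟩ := Submodule.mem_sup.1 (ih hy)
    have hlead : ⁅(d ^ m) u, (d ^ m) v⁆ ∈ I.toSubmodule ⊔
        (LieAlgebra.derivedSeriesOfIdeal F K (i + 1) I).toSubmodule.map (d ^ (m + m)) := by
      rw [← Submodule.smul_mem_iff _ hchoose, Nat.cast_smul_eq_nsmul]
      have hmap := Submodule.mem_sup_right (S := I.toSubmodule) (Submodule.mem_map_of_mem
        (f := d ^ (m + m)) (LieSubmodule.lie_mem_lie hu hv))
      rw [LieAlgebra.derivedSeriesOfIdeal_succ, ← sub_sub_cancel ((d ^ (m + m)) ⁅u, v⁆)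
        ((m + m).choose m • _)]
      exact sub_mem hmap (Submodule.mem_sup_left
        (pow_derivation_lie_sub_choose_smul_mem I D hu hv))
    rw [add_lie, lie_add ((d ^ m) u), ← add_assoc]
    exact add_mem (Submodule.mem_sup_left
      (add_mem (lie_mem_left F K I _ _ ha) (lie_mem_right F K I _ _ hb))) hlead

theorem IsSolregular.isCharacteristic_radical [FiniteDimensional F K] (h : IsSolregular F K) :
    IsCharacteristic (LieAlgebra.radical F K) := by
  refine isCharacteristic_of_addDerivation_le fun D => ?_
  rw [← LieAlgebra.LieIdeal.solvable_iff_le_radical]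
  refine isSolvable_of_derivedSeriesOfIdeal_le (J := LieAlgebra.radical F K)
    ((derivedSeriesOfIdeal_addDerivation_le _ D h.factorial_ne_zero).trans ?_)
  simp [derivedSeriesOfIdeal_derivedLength]

end CharacteristicRadical

section IdealsOfIdeals

variable {R L : Type*} [CommRing R] [LieRing L] [LieAlgebra R L] {C : LieIdeal R L}

variable (C) in
/-- The derivation of an ideal `C` induced by the adjoint action of an element of `L`. -/
def adRestrict (d : L) : LieDerivation R C C where
  toLinearMap := LieModule.toEnd R L C d
  leibniz' x y := Subtype.ext (by
    change ⁅d, ⁅(x : L), (y : L)⁆⁆ = ⁅(x : L), ⁅d, (y : L)⁆⁆ - ⁅(y : L), ⁅d, (x : L)⁆⁆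
    rw [leibniz_lie, ← lie_skew ⁅d, (x : L)⁆ (y : L)]; abel)

/-- A characteristic ideal `J` of an ideal `C` of `L`, as an ideal of `L`. -/
def IsCharacteristic.mapIncl {J : LieIdeal R C} (hJ : IsCharacteristic J) : LieIdeal R L where
  toSubmodule := J.toSubmodule.map C.toSubmodule.subtype
  lie_mem := by
    rintro d _ ⟨x, hx, rfl⟩
    exact ⟨_, hJ (adRestrict C d) x hx, rfl⟩

variable {J : LieIdeal R C} (hJ : IsCharacteristic J)

theorem IsCharacteristic.coe_mem_mapIncl {x : C} : (x : L) ∈ hJ.mapIncl ↔ x ∈ J :=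
  C.toSubmodule.subtype_injective.mem_set_image

theorem IsCharacteristic.mapIncl_le : hJ.mapIncl ≤ C := Submodule.map_subtype_le _ _

/-- The identification of `hJ.mapIncl` with `J`. -/
def IsCharacteristic.mapInclHom : hJ.mapIncl →ₗ⁅R⁆ J where
  toFun x := ⟨⟨x, hJ.mapIncl_le x.2⟩, hJ.coe_mem_mapIncl.1 x.2⟩
  map_add' _ _ := rfl
  map_smul' _ _ := rfl
  map_lie' := rfl

theorem IsCharacteristic.mapInclHom_injective : Function.Injective hJ.mapInclHom :=
  fun _ _ hxy => Subtype.ext (congrArg (fun z : J => ((z : C) : L)) hxy)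

end IdealsOfIdeals

section CentralizerOfNilradical

variable {F L : Type*} [Field F] [LieRing L] [LieAlgebra F L]

theorem centerOf_le_centerOf_centralizer (N : LieIdeal F L) :
    centerOf N ≤ centerOf (centralizer N) := fun z hz =>
  ⟨hz.2, fun c hc => by rw [← lie_skew, hc z hz.1, neg_zero]⟩

theorem lie_eq_zero_of_mem_comap_centerOf {C : LieIdeal F L} {x y : C}
    (hx : x ∈ (centerOf C).comap C.incl) : ⁅x, y⁆ = 0 :=
  Subtype.ext (hx.2 y y.2)

variable [FiniteDimensional F L]

theorem IsNilregular.radical_centralizer_nilradical_le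
    (h : IsNilregular F (centralizer (nilradical F L))) :
    LieAlgebra.radical F (centralizer (nilradical F L)) ≤
      (nilradical F L).comap (centralizer (nilradical F L)).incl := by
  set C := centralizer (nilradical F L)
  have hnil : nilradical F C ≤ (nilradical F L).comap C.incl := fun x hx => by
    have hchar := h.isCharacteristic_nilradical
    have : LieRing.IsNilpotent hchar.mapIncl := hchar.mapInclHom_injective.lieAlgebra_isNilpotent
    exact le_nilradical _ (hchar.coe_mem_mapIncl.2 hx)
  refine (le_nilradical_of_isSolvable (LieAlgebra.radical F C) fun x _ y hy => ?_).trans hnil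
  exact Subtype.ext (x.2 y (hnil hy))

theorem IsSolregular.radical_centralizer_nilradical_le
    (h : IsSolregular F (centralizer (nilradical F L))) :
    LieAlgebra.radical F (centralizer (nilradical F L)) ≤
      (nilradical F L).comap (centralizer (nilradical F L)).incl := fun x hx => by
  have hchar := h.isCharacteristic_radical
  have : LieAlgebra.IsSolvable hchar.mapIncl := hchar.mapInclHom_injective.lieAlgebra_isSolvable
  exact le_nilradical_of_isSolvable _ hchar.mapIncl_le (hchar.coe_mem_mapIncl.2 hx)

theorem IsRegular.radical_centralizer_nilradical
    (h : IsRegular F (centralizer (nilradical F L))) :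
    LieAlgebra.radical F (centralizer (nilradical F L)) =
      (centerOf (nilradical F L)).comap (centralizer (nilradical F L)).incl := by
  have hle := h.elim IsNilregular.radical_centralizer_nilradical_le
    IsSolregular.radical_centralizer_nilradical_le
  refine le_antisymm (fun x hx => ⟨hle hx, x.2⟩) ?_
  have : IsLieAbelian
      ((centerOf (nilradical F L)).comap (centralizer (nilradical F L)).incl) :=
    ⟨fun x _ => Subtype.ext
      (lie_eq_zero_of_mem_comap_centerOf (centerOf_le_centerOf_centralizer _ x.2))⟩
  exact (LieAlgebra.LieIdeal.solvable_iff_le_radical F _ _).1 inferInstance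

end CentralizerOfNilradical

section Frattini

section CommRing

variable {R K : Type*} [CommRing R] [LieRing K] [LieAlgebra R K]

/-- The subalgebra `I + M` for an ideal `I` and a subalgebra `M`. -/
def idealSup (I : LieIdeal R K) (M : LieSubalgebra R K) : LieSubalgebra R K where
  toSubmodule := I.toSubmodule ⊔ M.toSubmodule
  lie_mem' := by
    intro a b ha hb
    obtain ⟨i, hi, m, hm, rfl⟩ := Submodule.mem_sup.1 ha
    obtain ⟨j, hj, n, hn, rfl⟩ := Submodule.mem_sup.1 hb
    rw [add_lie, lie_add m, ← add_assoc]
    exact Submodule.add_mem_sup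
      (add_mem (lie_mem_left R K I _ _ hi) (lie_mem_right R K I _ _ hj)) (M.lie_mem hm hn)

theorem sup_eq_top_of_isCoatom {I : LieIdeal R K} {M : LieSubalgebra R K} (hM : IsCoatom M)
    {x : K} (hxI : x ∈ I) (hxM : x ∉ M) : I.toSubmodule ⊔ M.toSubmodule = ⊤ :=
  congrArg LieSubalgebra.toSubmodule (hM.2 (idealSup I M) (SetLike.lt_iff_le_and_exists.2
    ⟨fun _ hm => Submodule.mem_sup_right hm, x, Submodule.mem_sup_left hxI, hxM⟩))

end CommRing

variable {F K : Type*} [Field F] [LieRing K] [LieAlgebra F K] {Z C : LieIdeal F K}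
  {U : LieSubalgebra F K}

/-- The intersection `C ∩ U` of an ideal and a subalgebra, as an ideal: `U` normalises it, and an
ideal `Z` that centralises it makes up the rest of the algebra. -/
def infIdeal (hZ : Z ≤ centralizer C) (hU : Z.toSubmodule ⊔ U.toSubmodule = ⊤) :
    LieIdeal F K where
  toSubmodule := C.toSubmodule ⊓ U.toSubmodule
  lie_mem := by
    rintro x y ⟨hyC, hyU⟩
    obtain ⟨z, hz, u, hu, rfl⟩ :=
      Submodule.mem_sup.1 (hU ▸ Submodule.mem_top : x ∈ Z.toSubmodule ⊔ U.toSubmodule)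
    rw [add_lie, hZ hz y hyC, zero_add]
    exact ⟨C.lie_mem hyC, U.lie_mem hu hyU⟩

theorem infIdeal_le_frattiniIdeal (hZ : Z ≤ centralizer Z)
    (hU : Z.toSubmodule ⊔ U.toSubmodule = ⊤)
    (hmin : ∀ V ≤ U, Z.toSubmodule ⊔ V.toSubmodule = ⊤ → U ≤ V) :
    infIdeal hZ hU ≤ frattiniIdeal F K := by
  refine le_sSup fun M hM x hx => by_contra fun hxM => ?_
  have htop : (Z.toSubmodule ⊓ U.toSubmodule) ⊔ M.toSubmodule = ⊤ :=
    sup_eq_top_of_isCoatom (I := infIdeal hZ hU) hM hx hxM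
  have hUM : U.toSubmodule = (Z.toSubmodule ⊓ U.toSubmodule) ⊔ (M ⊓ U).toSubmodule := by
    rw [LieSubalgebra.inf_toSubmodule, ← sup_inf_assoc_of_le _ inf_le_right, htop, top_inf_eq]
  have hZM : Z.toSubmodule ⊔ (M ⊓ U).toSubmodule = ⊤ := by
    rw [← sup_inf_self (a := Z.toSubmodule) (b := U.toSubmodule), sup_assoc, ← hUM, hU]
  exact hxM (hmin _ inf_le_right hZM hx.2).1

theorem exists_isCompl_of_frattiniIdeal_inf_eq_bot [FiniteDimensional F K]
    (hZ : Z ≤ centralizer Z) (hfr : frattiniIdeal F K ⊓ Z = ⊥) :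
    ∃ U : LieSubalgebra F K, IsCompl Z.toSubmodule U.toSubmodule := by
  obtain ⟨U, hU, hmin⟩ := WellFounded.has_min
    (InvImage.wf LieSubalgebra.toSubmodule (wellFounded_lt (α := Submodule F K)))
    {U | Z.toSubmodule ⊔ U.toSubmodule = ⊤} ⟨⊤, by simp⟩
  have hle : infIdeal hZ hU ≤ frattiniIdeal F K := infIdeal_le_frattiniIdeal hZ hU fun V hVU hV =>
    not_not.1 fun hUV => hmin V hV (lt_of_le_not_ge hVU hUV)
  refine ⟨U, disjoint_iff.2 ((Submodule.eq_bot_iff _).2 fun x hx => ?_), codisjoint_iff.2 hU⟩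
  exact (LieSubmodule.eq_bot_iff _).1 hfr x ⟨hle hx, hx.1⟩

end Frattini

section Semisimple

section CommRing

variable {R K : Type*} [CommRing R] [LieRing K] [LieAlgebra R K]

/-- The quotient map by an ideal, as a homomorphism of Lie algebras. -/
def quotientMk (I : LieIdeal R K) : K →ₗ⁅R⁆ K ⧸ I where
  toLinearMap := (LieSubmodule.Quotient.mk' I : K →ₗ[R] K ⧸ I)
  map_lie' := rfl

theorem quotientMk_surjective (I : LieIdeal R K) : Function.Surjective (quotientMk I) :=
  LieSubmodule.Quotient.surjective_mk' I

theorem quotientMk_eq_zero {I : LieIdeal R K} {x : K} : quotientMk I x = 0 ↔ x ∈ I :=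
  LieSubmodule.Quotient.mk_eq_zero I

theorem ker_quotientMk (I : LieIdeal R K) : (quotientMk I).ker = I :=
  LieSubmodule.ext _ _ fun _ => quotientMk_eq_zero

theorem hasTrivialRadical_of_surjective {S : Type*} [LieRing S] [LieAlgebra R S]
    [IsNoetherian R K] {f : K →ₗ⁅R⁆ S} (hf : Function.Surjective f)
    (hker : f.ker = LieAlgebra.radical R K) : LieAlgebra.HasTrivialRadical R S := by
  rw [LieAlgebra.hasTrivialRadical_iff_no_abelian_ideals]
  intro J hJ
  have hle : ⁅J.comap f, J.comap f⁆ ≤ LieAlgebra.radical R K := by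
    rw [← hker, LieSubmodule.lie_le_iff]
    intro x hx y hy
    rw [LieHom.mem_ker, LieHom.map_lie]
    exact congrArg Subtype.val (hJ.trivial ⟨f x, hx⟩ ⟨f y, hy⟩)
  have : LieAlgebra.IsSolvable (J.comap f) := isSolvable_of_derivedSeriesOfIdeal_le (k := 1) hle
  have hJker : J.comap f ≤ f.ker :=
    hker ▸ (LieAlgebra.LieIdeal.solvable_iff_le_radical R K _).1 this
  refine (LieSubmodule.eq_bot_iff _).2 fun y hy => ?_
  obtain ⟨x, rfl⟩ := hf y
  exact hJker hy

theorem isSolvable_comap_incl (I J : LieIdeal R K) [LieAlgebra.IsSolvable J] :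
    LieAlgebra.IsSolvable (J.comap I.incl) := by
  let f : J.comap I.incl →ₗ⁅R⁆ J :=
    { toFun x := ⟨x.1, x.2⟩, map_add' _ _ := rfl, map_smul' _ _ := rfl, map_lie' := rfl }
  have hf : Function.Injective f := fun _ _ h =>
    Subtype.ext (Subtype.ext (congrArg (fun y : J => (y : K)) h))
  exact hf.lieAlgebra_isSolvable

end CommRing

variable {F L : Type*} [Field F] [LieRing L] [LieAlgebra F L]

theorem IsVectorDirectSum.right_le {A B C : Submodule F L} (h : IsVectorDirectSum C A B) :
    B ≤ C :=
  h.2 ▸ le_sup_right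

theorem IsVectorDirectSum.exists_add_eq {A B C : Submodule F L} (h : IsVectorDirectSum C A B)
    {c : L} (hc : c ∈ C) : ∃ a ∈ A, ∃ b ∈ B, a + b = c :=
  Submodule.mem_sup.1 (h.2.symm ▸ hc)

variable [FiniteDimensional F L] {C Z S : LieIdeal F L}

theorem hasTrivialRadical_of_isVectorDirectSum {B : LieSubalgebra F L}
    (hrad : LieAlgebra.radical F C = Z.comap C.incl)
    (h : IsVectorDirectSum C.toSubmodule Z.toSubmodule B.toSubmodule) :
    LieAlgebra.HasTrivialRadical F B := by
  let i : B →ₗ⁅F⁆ C :=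
    { toFun b := ⟨b, h.right_le b.2⟩, map_add' _ _ := rfl, map_smul' _ _ := rfl, map_lie' := rfl }
  let f : B →ₗ⁅F⁆ C ⧸ LieAlgebra.radical F C := (quotientMk _).comp i
  have hinj : Function.Injective f := by
    refine (injective_iff_map_eq_zero f).2 fun b hb => Subtype.ext ?_
    have hbZ : i b ∈ Z.comap C.incl := hrad ▸ quotientMk_eq_zero.1 hb
    exact (Submodule.eq_bot_iff _).1 h.1 b ⟨hbZ, b.2⟩
  have hsurj : Function.Surjective f := by
    intro y
    obtain ⟨c, rfl⟩ := quotientMk_surjective _ y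
    obtain ⟨z, hz, b, hb, hzb⟩ := h.exists_add_eq c.2
    refine ⟨⟨b, hb⟩, sub_eq_zero.1 ?_⟩
    rw [LieHom.comp_apply, ← map_sub, quotientMk_eq_zero, hrad, ← neg_mem_iff, neg_sub]
    change (c : L) - b ∈ Z
    rwa [← eq_sub_of_add_eq hzb]
  let e := LieEquiv.ofBijective f ⟨hinj, hsurj⟩
  refine hasTrivialRadical_of_surjective (f := e.symm.toLieHom.comp (quotientMk _))
    (e.symm.surjective.comp (quotientMk_surjective _)) ?_
  exact LieSubmodule.ext _ _ fun c =>
    (map_eq_zero_iff e.symm e.symm.injective).trans quotientMk_eq_zero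

theorem IsAlgebraDirectSum.isSemisimpleIdeal (hrad : LieAlgebra.radical F C = Z.comap C.incl)
    (h : IsAlgebraDirectSum C Z S) : IsSemisimpleIdeal S :=
  hasTrivialRadical_of_isVectorDirectSum (B := LieIdeal.toLieSubalgebra F L S) hrad h.1

theorem IsSemisimpleIdeal.inf_nilradical (hS : IsSemisimpleIdeal S) :
    S ⊓ nilradical F L = ⊥ := by
  have hbot := (LieAlgebra.hasTrivialRadical_iff_no_solvable_ideals F S).1 hS _
    (isSolvable_comap_incl S (nilradical F L))
  refine (LieSubmodule.eq_bot_iff _).2 fun x hx => ?_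
  exact congrArg Subtype.val ((LieSubmodule.eq_bot_iff _).1 hbot ⟨x, hx.1⟩ hx.2)

theorem IsSemisimpleIdeal.le_centralizer_nilradical (hS : IsSemisimpleIdeal S) :
    S ≤ centralizer (nilradical F L) := fun x hx y hy =>
  (LieSubmodule.eq_bot_iff _).1 hS.inf_nilradical _
    ⟨lie_mem_left F L S x y hx, lie_mem_right F L _ x y hy⟩

theorem maximal_isSemisimpleIdeal_of_isAlgebraDirectSum {B : LieIdeal F L}
    (h : IsAlgebraDirectSum (centralizer (nilradical F L)) (centerOf (nilradical F L)) B)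
    (hB : IsSemisimpleIdeal B) : Maximal IsSemisimpleIdeal B := by
  refine ⟨hB, fun S hS hBS s hs => ?_⟩
  obtain ⟨z, hz, b, hb, rfl⟩ := h.1.exists_add_eq (hS.le_centralizer_nilradical hs)
  have hzS : z ∈ S := (add_mem_cancel_right (hBS hb)).1 hs
  rwa [(LieSubmodule.eq_bot_iff _).1 hS.inf_nilradical z ⟨hzS, hz.1⟩, zero_add]

end Semisimple

section DirectSums

variable {F L : Type*} [Field F] [LieRing L] [LieAlgebra F L] {C Z : LieIdeal F L}

theorem isVectorDirectSum_of_isCompl (hZC : Z ≤ C) {U : Submodule F C}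
    (h : IsCompl (Z.comap C.incl).toSubmodule U) :
    IsVectorDirectSum C.toSubmodule Z.toSubmodule (U.map C.toSubmodule.subtype) := by
  have hZ : Z.toSubmodule = (Z.comap C.incl).toSubmodule.map C.toSubmodule.subtype :=
    (Submodule.map_comap_subtype _ _).trans (inf_eq_right.2 hZC) |>.symm
  constructor
  · rw [hZ, ← Submodule.map_inf _ C.toSubmodule.subtype_injective, h.inf_eq_bot, Submodule.map_bot]
  · rw [hZ, ← Submodule.map_sup, h.sup_eq_top, Submodule.map_subtype_top]

theorem isVectorDirectSum_inf (hZC : Z ≤ C) {U : Submodule F L} (h : IsCompl Z.toSubmodule U) :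
    IsVectorDirectSum C.toSubmodule Z.toSubmodule (C.toSubmodule ⊓ U) := by
  refine ⟨disjoint_iff.1 (h.disjoint.mono_right inf_le_right), ?_⟩
  rw [inf_comm, ← sup_inf_assoc_of_le U hZC, h.sup_eq_top, top_inf_eq]

theorem lie_self_eq_square {B : LieSubalgebra F L} (hZ : Z ≤ centerOf C)
    (h : IsVectorDirectSum C.toSubmodule Z.toSubmodule B.toSubmodule) :
    (⁅C, C⁆ : LieIdeal F L).toSubmodule = square B := by
  rw [LieSubmodule.lieIdeal_oper_eq_linear_span', square]
  congr 1
  ext w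
  constructor
  · rintro ⟨x, hx, y, hy, rfl⟩
    obtain ⟨z, hz, b, hb, rfl⟩ := h.exists_add_eq hx
    obtain ⟨z', hz', b', hb', rfl⟩ := h.exists_add_eq hy
    refine ⟨b, hb, b', hb', ?_⟩
    rw [add_lie, (hZ hz).2 _ hy, zero_add, lie_add, ← lie_skew b z',
      (hZ hz').2 _ (h.right_le hb), neg_zero, zero_add]
  · rintro ⟨x, hx, y, hy, rfl⟩
    exact ⟨x, h.right_le hx, y, h.right_le hy, rfl⟩

variable [FiniteDimensional F L]

theorem exists_subalgebra_isVectorDirectSum (hZ : Z ≤ centerOf C)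
    (hfr : frattiniOf C ⊓ Z.toSubmodule = ⊥) :
    ∃ B : LieSubalgebra F L,
      IsVectorDirectSum C.toSubmodule Z.toSubmodule B.toSubmodule := by
  obtain ⟨U, hU⟩ := exists_isCompl_of_frattiniIdeal_inf_eq_bot (Z := Z.comap C.incl)
    (fun x hx y _ => Subtype.ext ((hZ hx).2 y y.2))
    ((LieSubmodule.eq_bot_iff _).2 fun x hx => Subtype.ext
      ((Submodule.eq_bot_iff _).1 hfr x ⟨⟨x, hx.1, rfl⟩, hx.2⟩))
  exact ⟨U.map C.incl, isVectorDirectSum_of_isCompl (hZ.trans inf_le_left) hU⟩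

theorem exists_ideal_isAlgebraDirectSum (hZ : Z ≤ centerOf C)
    (hfr : frattiniIdeal F L ⊓ Z = ⊥) : ∃ B : LieIdeal F L, IsAlgebraDirectSum C Z B := by
  obtain ⟨U, hU⟩ := exists_isCompl_of_frattiniIdeal_inf_eq_bot
    (fun x hx y hy => (hZ hx).2 y (hZ hy).1) hfr
  exact ⟨infIdeal (hZ.trans inf_le_right) hU.sup_eq_top,
    isVectorDirectSum_inf (hZ.trans inf_le_left) hU, fun z hz b hb => (hZ hz).2 b hb.1⟩

end DirectSums

section CharacteristicZero

attribute [local instance] LieRing.ofAssociativeRing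

variable {F K S : Type*} [Field F] [LieRing K] [LieAlgebra F K] [LieRing S] [LieAlgebra F S]

theorem lie_top_top_of_isKilling [FiniteDimensional F S] [LieAlgebra.IsKilling F S] :
    ⁅(⊤ : LieIdeal F S), (⊤ : LieIdeal F S)⁆ = ⊤ := by
  set I := ⁅(⊤ : LieIdeal F S), (⊤ : LieIdeal F S)⁆
  have hcompl := LieIdeal.isCompl_killingCompl I
  have : IsLieAbelian (LieIdeal.killingCompl F S I) := ⟨fun x y => Subtype.ext <| by
    have hxy : ⁅(x : S), (y : S)⁆ ∈ I ⊓ LieIdeal.killingCompl F S I :=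
      ⟨LieSubmodule.lie_mem_lie trivial trivial, lie_mem_right F S _ _ _ y.2⟩
    rwa [hcompl.inf_eq_bot] at hxy⟩
  rw [← hcompl.sup_eq_top, LieAlgebra.IsKilling.ideal_eq_bot_of_isLieAbelian
    (LieIdeal.killingCompl F S I), sup_bot_eq]

theorem exists_eq_killingForm_lie [FiniteDimensional F S] [LieAlgebra.IsKilling F S]
    (f : S →ₗ[F] S →ₗ[F] F) (hf : ∀ x y z, f ⁅x, y⁆ z = f x ⁅y, z⁆ - f y ⁅x, z⁆) :
    ∃ a, ∀ x y, f x y = killingForm F S a ⁅x, y⁆ := by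
  -- Through the Killing form, the cocycle `f` becomes a derivation, which is inner.
  have hκ := LieAlgebra.IsKilling.killingForm_nondegenerate F S
  let κ : LinearMap.BilinForm F S := killingForm F S
  have hinv : ∀ x y z, κ ⁅x, y⁆ z = κ x ⁅y, z⁆ := LieModule.traceForm_apply_lie_apply F S S
  let δ : S →ₗ[F] S := (κ.toDual hκ).symm.toLinearMap ∘ₗ f
  have hδ : ∀ x y, κ (δ x) y = f x y := fun _ _ =>
    LinearMap.BilinForm.apply_toDual_symm_apply (hB := hκ) _ _
  let D : LieDerivation F S S :=
    { toLinearMap := δ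
      leibniz' := fun x y => by
        refine sub_eq_zero.1 (hκ.1 _ fun z => ?_)
        change κ (δ ⁅x, y⁆ - (⁅x, δ y⁆ - ⁅y, δ x⁆)) z = 0
        rw [← lie_skew x (δ y), ← lie_skew y (δ x)]
        simp only [map_sub, map_neg, LinearMap.sub_apply, LinearMap.neg_apply, hinv, hδ, hf]
        ring }
  obtain ⟨a, ha⟩ := LieDerivation.IsKilling.exists_eq_ad D
  refine ⟨a, fun x y => ?_⟩
  have hax : δ x = ⁅a, x⁆ := by
    rw [← LieAlgebra.ad_apply F, ← LieDerivation.coe_ad_apply_eq_ad_apply, ha]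
  rw [← hδ, hax, hinv]

theorem exists_descends_of_surjective {V W : Type*} [AddCommGroup V] [Module F V]
    [AddCommGroup W] [Module F W] {π : V →ₗ[F] W} (hπ : Function.Surjective π)
    (b : V →ₗ[F] V →ₗ[F] F) (hl : ∀ x y, π x = 0 → b x y = 0) (hr : ∀ x y, π y = 0 → b x y = 0) :
    ∃ f : W →ₗ[F] W →ₗ[F] F, ∀ x y, f (π x) (π y) = b x y := by
  obtain ⟨s, hs⟩ := π.exists_rightInverse_of_surjective (LinearMap.range_eq_top.2 hπ)
  have hker : ∀ x, π (s (π x) - x) = 0 := fun x => by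
    rw [map_sub, sub_eq_zero]
    exact LinearMap.congr_fun hs (π x)
  refine ⟨b.compl₁₂ s s, fun x y => ?_⟩
  have hx := hl (s (π x) - x) (s (π y)) (hker x)
  have hy := hr x (s (π y) - y) (hker y)
  rw [map_sub, LinearMap.sub_apply, sub_eq_zero] at hx
  rw [map_sub, sub_eq_zero] at hy
  exact hx.trans hy

variable [FiniteDimensional F S] [LieAlgebra.IsKilling F S] {π : K →ₗ⁅F⁆ S}

theorem exists_dual_lie_eq_killingForm (hπ : Function.Surjective π)
    (hker : π.ker ≤ centralizer ⊤) (l : Module.Dual F K) :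
    ∃ a, ∀ x y : K, l ⁅x, y⁆ = killingForm F S a (π ⁅x, y⁆) := by
  have hzero : ∀ x y : K, π x = 0 → l ⁅x, y⁆ = 0 := fun x y hx => by
    rw [hker (LieHom.mem_ker.2 hx) y trivial, map_zero]
  obtain ⟨f, hf⟩ := exists_descends_of_surjective (π := π.toLinearMap) hπ
    ((LieModule.toEnd F K K : K →ₗ[F] Module.End F K).compr₂ l) hzero
    (fun x y hy => by
      change l ⁅x, y⁆ = 0
      rw [← lie_skew, map_neg, hzero y x hy, neg_zero])
  replace hf : ∀ x y : K, f (π x) (π y) = l ⁅x, y⁆ := hf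
  obtain ⟨a, ha⟩ := exists_eq_killingForm_lie f fun x y z => by
    obtain ⟨x, rfl⟩ := hπ x
    obtain ⟨y, rfl⟩ := hπ y
    obtain ⟨z, rfl⟩ := hπ z
    simp only [← LieHom.map_lie, hf, lie_lie, map_sub]
  exact ⟨a, fun x y => by rw [← hf, ha, LieHom.map_lie]⟩

theorem disjoint_ker_lie_top_top (hπ : Function.Surjective π) (hker : π.ker ≤ centralizer ⊤) :
    Disjoint π.ker ⁅(⊤ : LieIdeal F K), (⊤ : LieIdeal F K)⁆ := by
  refine disjoint_iff_inf_le.2 fun w ⟨hwker, hw⟩ =>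
    (Module.forall_dual_apply_eq_zero_iff F w).1 fun l => ?_
  obtain ⟨a, ha⟩ := exists_dual_lie_eq_killingForm hπ hker l
  have heq : ⁅(⊤ : LieIdeal F K), (⊤ : LieIdeal F K)⁆.toSubmodule ≤
      LinearMap.eqLocus l (killingForm F S a ∘ₗ π.toLinearMap) := by
    rw [LieSubmodule.lieIdeal_oper_eq_linear_span', Submodule.span_le]
    rintro _ ⟨x, -, y, -, rfl⟩
    exact ha x y
  rw [show l w = killingForm F S a (π w) from heq hw, LieHom.mem_ker.1 hwker, map_zero]

theorem codisjoint_ker_lie_top_top (hπ : Function.Surjective π) :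
    Codisjoint π.ker ⁅(⊤ : LieIdeal F K), (⊤ : LieIdeal F K)⁆ := by
  have hmap : LieIdeal.map π ⁅(⊤ : LieIdeal F K), (⊤ : LieIdeal F K)⁆ = ⊤ := by
    rw [LieIdeal.map_bracket_eq π hπ, ← LieHom.idealRange_eq_map,
      LieHom.idealRange_eq_top_of_surjective _ hπ, lie_top_top_of_isKilling]
  refine codisjoint_iff_le_sup.2 fun x _ => ?_
  obtain ⟨y, hy⟩ := LieIdeal.mem_map_of_surjective hπ (hmap ▸ LieSubmodule.mem_top (π x))
  refine (LieSubmodule.mem_sup _ _ _).2 ⟨x - y, ?_, y, y.2, sub_add_cancel _ _⟩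
  rw [LieHom.mem_ker, map_sub, hy, sub_self]

theorem isCompl_radical_lie_top_top [CharZero F] [FiniteDimensional F K]
    (h : LieAlgebra.radical F K ≤ centralizer ⊤) :
    IsCompl (LieAlgebra.radical F K) ⁅(⊤ : LieIdeal F K), (⊤ : LieIdeal F K)⁆ := by
  have hsurj := quotientMk_surjective (LieAlgebra.radical F K)
  have hker := ker_quotientMk (LieAlgebra.radical F K)
  have : LieAlgebra.HasTrivialRadical F (K ⧸ LieAlgebra.radical F K) :=
    hasTrivialRadical_of_surjective hsurj hker
  have : FiniteDimensional F (K ⧸ LieAlgebra.radical F K) := Module.Finite.of_surjective _ hsurj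
  rw [← hker] at h
  have hcompl := IsCompl.mk (disjoint_ker_lie_top_top hsurj h) (codisjoint_ker_lie_top_top hsurj)
  rwa [hker] at hcompl

variable {L : Type*} [LieRing L] [LieAlgebra F L]

theorem comap_incl_lie_self (C : LieIdeal F L) :
    (⁅C, C⁆ : LieIdeal F L).comap C.incl = ⁅(⊤ : LieIdeal F C), (⊤ : LieIdeal F C)⁆ := by
  rw [← LieIdeal.comap_incl_self C, LieIdeal.comap_bracket_incl_of_le (I := C) le_rfl le_rfl]

variable [CharZero F] [FiniteDimensional F L] {C Z : LieIdeal F L}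

theorem isAlgebraDirectSum_lie_self (hZ : Z ≤ centerOf C)
    (hrad : LieAlgebra.radical F C = Z.comap C.incl) : IsAlgebraDirectSum C Z ⁅C, C⁆ := by
  have hcompl := isCompl_radical_lie_top_top
    (hrad.trans_le fun x hx y _ => Subtype.ext ((hZ hx).2 y y.2))
  rw [hrad, ← comap_incl_lie_self, ← LieSubmodule.isCompl_toSubmodule] at hcompl
  have hmap : ((⁅C, C⁆ : LieIdeal F L).comap C.incl).toSubmodule.map C.toSubmodule.subtype =
      (⁅C, C⁆ : LieIdeal F L).toSubmodule :=
    (Submodule.map_comap_subtype _ _).trans (inf_eq_right.2 (LieSubmodule.lie_le_left C C))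
  exact ⟨hmap ▸ isVectorDirectSum_of_isCompl (hZ.trans inf_le_left) hcompl,
    fun z hz b hb => (hZ hz).2 b (LieSubmodule.lie_le_left C C hb)⟩

theorem IsSemisimpleIdeal.le_lie_self {S : LieIdeal F L} (hS : IsSemisimpleIdeal S) :
    S ≤ ⁅S, S⁆ := by
  have : LieAlgebra.HasTrivialRadical F S := hS
  have htop : (⁅S, S⁆ : LieIdeal F L).comap S.incl = ⊤ :=
    (comap_incl_lie_self S).trans lie_top_top_of_isKilling
  exact fun x hx => (htop ▸ LieSubmodule.mem_top (⟨x, hx⟩ : S) : _ ∈ LieIdeal.comap S.incl _)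

end CharacteristicZero

end LieNilrad

theorem corollaryc {F L : Type*} [Field F] [LieRing L] [LieAlgebra F L] [FiniteDimensional F L]
    (N Z C : LieIdeal F L)
    (hN : N = LieNilrad.nilradical F L)
    (hZ : Z = LieNilrad.centerOf N)
    (hC : C = LieNilrad.centralizer N)
    (hreg : LieNilrad.IsRegular F C) :
    (LieNilrad.frattiniOf C ⊓ Z.toSubmodule = ⊥ →
      ∃ B : LieSubalgebra F L,
        LieNilrad.IsVectorDirectSum C.toSubmodule Z.toSubmodule B.toSubmodule ∧
        LieAlgebra.HasTrivialRadical F B ∧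
        ∃ J : LieIdeal F L, J.toSubmodule = LieNilrad.square B) ∧
    (LieNilrad.frattiniIdeal F L ⊓ Z = ⊥ →
      ∃ B : LieIdeal F L,
        LieNilrad.IsAlgebraDirectSum C Z B ∧
        Maximal LieNilrad.IsSemisimpleIdeal B) ∧
    (CharZero F →
      ∃ S : LieIdeal F L,
        LieNilrad.IsAlgebraDirectSum C Z S ∧
        IsGreatest {I : LieIdeal F L | LieNilrad.IsSemisimpleIdeal I} S) := by
  subst hN hZ hC
  have hZ := LieNilrad.centerOf_le_centerOf_centralizer (LieNilrad.nilradical F L)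
  have hrad := hreg.radical_centralizer_nilradical
  refine ⟨fun hfr => ?_, fun hfr => ?_, fun _ => ?_⟩
  · obtain ⟨B, hB⟩ := LieNilrad.exists_subalgebra_isVectorDirectSum hZ hfr
    exact ⟨B, hB, LieNilrad.hasTrivialRadical_of_isVectorDirectSum hrad hB, _,
      LieNilrad.lie_self_eq_square hZ hB⟩
  · obtain ⟨B, hB⟩ := LieNilrad.exists_ideal_isAlgebraDirectSum hZ hfr
    exact ⟨B, hB, LieNilrad.maximal_isSemisimpleIdeal_of_isAlgebraDirectSum hB
      (hB.isSemisimpleIdeal hrad)⟩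
  · have hS := LieNilrad.isAlgebraDirectSum_lie_self hZ hrad
    refine ⟨_, hS, hS.isSemisimpleIdeal hrad, fun I hI => ?_⟩
    have hIC := hI.le_centralizer_nilradical
    exact hI.le_lie_self.trans (LieSubmodule.mono_lie hIC hIC)
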